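/- Let $X$ be a complex Banach space. Let $BUC(\mathbb R^+,X)$ be the space of bounded uniformly continuous functions $[0,\infty)\to X$ with the sup-norm, $C_0(\mathbb R^+,X)$ its closed subspace of functions with $\lim_{t\to\infty}\|f(t)\|=0$, and $\mathbb Y:=BUC(\mathbb R^+,X)/C_0(\mathbb R^+,X)$ with the quotient norm; write $\tilde f\in\mathbb Y$ for the class of $f$. Let $\mathcal D=d/dt$ be the operator in $BUC(\mathbb R^+,X)$ with domain $D(\mathcal D)=\{u\in BUC(\mathbb R^+,X):\ u' \text{ exists and } u'\in BUC(\mathbb R^+,X)\}$, and let $\tilde{\mathcal D}$ be the (well-defined) induced operator in $\mathbb Y$: its domain is $\{\tilde f:\ \exists u\in\tilde f,\ u\in D(\mathcal D)\}$, and $\tilde{\mathcal D}\tilde f:=\widetilde{\mathcal D u}$ for any such $u$. For a linear operator $T$ with domain $D(T)\subset E$ in a complex normed space $E$, let $\rho(T)$ be the set of $\lambda\in\mathbb C$ for which $\lambda-T:D(T)\to E$ is bijective with bounded inverse, and $\sigma(T)=\mathbb C\setminus\rho(T)$. For $f\in BUC(\mathbb R^+,X)$ put $\hat f(\lambda)=(\lambda-\tilde{\mathcal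 D})^{-1}\tilde f$, $\lambda\in\rho(\tilde{\mathcal D})$, and let $sp(f)$ be the set of all $\xi_0\in\mathbb R$ such that $\hat f$ has no analytic extension to any neighborhood of $i\xi_0$. For $t\ge 0$ the translation $(S(t)f)(s)=f(s+t)$ induces an invertible operator $\tilde S(t)$ on $\mathbb Y$; with $\tilde S(-t):=\tilde S(t)^{-1}$, $(\tilde S(t))_{t\in\mathbb R}$ is a $C_0$-group of isometries. Let $\mathcal M_f$ be the closed linear span in $\mathbb Y$ of $\{\tilde S(t)\tilde f:\ t\in\mathbb R\}$, which is invariant under the group, and let $\tilde{\mathcal D}|_{\mathcal M_f}$ be the infinitesimal generator of the restricted group $(\tilde S(t)|_{\mathcal M_f})_{t\in\mathbb R}$. **Lemma.** For every $f\in BUC(\mathbb R^+,X)$, $$ i\cdot sp(f)=\sigma\big(\tilde{\mathcal D}|_{\mathcal M_f}\big). $$ -/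

import Mathlib

open Filter Topology Set
open scoped NNReal BoundedContinuousFunction

noncomputable section

/-! ### Unbounded operators: resolvent and spectrum, generators of one-parameter groups -/

namespace UnboundedOp

variable {E : Type*} [NormedAddCommGroup E] [NormedSpace ℂ E]

/-- `R` is a bounded everywhere defined two-sided inverse of `z - T : D(T) → E`. -/
def IsResolvent (T : E →ₗ.[ℂ] E) (z : ℂ) (R : E →L[ℂ] E) : Prop :=
  (∀ y : E, ∃ x : T.domain, (x : E) = R y ∧ z • (x : E) - T x = y) ∧
    ∀ x : T.domain, R (z • (x : E) - T x) = x

/-- The resolvent set `ρ(T)`: the `z` for which `z - T` is a bijection from `D(T)` onto `E` with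
bounded inverse. -/
def resolventSet (T : E →ₗ.[ℂ] E) : Set ℂ := {z | ∃ R : E →L[ℂ] E, IsResolvent T z R}

/-- The spectrum `σ(T)`, the complement of the resolvent set. -/
def spectrum (T : E →ₗ.[ℂ] E) : Set ℂ := (resolventSet T)ᶜ

open scoped Classical in
/-- The resolvent `(z - T)⁻¹`, meaningful for `z ∈ ρ(T)` (and `0` by convention elsewhere). -/
def resolvent (T : E →ₗ.[ℂ] E) (z : ℂ) : E →L[ℂ] E :=
  if h : ∃ R : E →L[ℂ] E, IsResolvent T z R then h.choose else 0

theorem isResolvent_resolvent {T : E →ₗ.[ℂ] E} {z : ℂ} (hz : z ∈ resolventSet T) :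
    IsResolvent T z (resolvent T z) := by
  have h : ∃ R : E →L[ℂ] E, IsResolvent T z R := hz
  rw [resolvent, dif_pos h]
  exact h.choose_spec

theorem IsResolvent.unique {T : E →ₗ.[ℂ] E} {z : ℂ} {R R' : E →L[ℂ] E}
    (h : IsResolvent T z R) (h' : IsResolvent T z R') : R = R' := by
  ext y
  obtain ⟨x, hx, hxy⟩ := h.1 y
  rw [← hx, ← hxy, h'.2 x]

/-- The graph of the infinitesimal generator of a family `(G t)` of operators indexed by `t ∈ ℝ`:
the pairs `(x, y)` with `(G t x - x) / t → y` as `t → 0`. -/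
def generatorGraph (G : ℝ → E →L[ℂ] E) : Submodule ℂ (E × E) where
  carrier := {p | Tendsto (fun t : ℝ => (t : ℂ)⁻¹ • (G t p.1 - p.1)) (𝓝[≠] 0) (𝓝 p.2)}
  zero_mem' := by simp
  add_mem' := by
    intro p q hp hq
    refine (Tendsto.add hp hq).congr fun t => ?_
    simp only [Prod.fst_add, map_add, ← smul_add]
    congr 1
    abel
  smul_mem' := by
    intro c p hp
    refine (Tendsto.const_smul hp c).congr fun t => ?_
    simp only [Prod.smul_fst, map_smul, ← smul_sub]
    rw [smul_comm]

/-- The infinitesimal generator of a one-parameter group `(G t)`, `t ∈ ℝ`: its domain consists of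
the `x` for which `(G t x - x) / t` converges as `t → 0`, and its value at `x` is the limit. -/
def generator (G : ℝ → E →L[ℂ] E) : E →ₗ.[ℂ] E := (generatorGraph G).toLinearPMap

theorem generator_graph (G : ℝ → E →L[ℂ] E) : (generator G).graph = generatorGraph G := by
  refine Submodule.toLinearPMap_graph_eq _ ?_
  rintro ⟨x, y⟩ h hx
  have hx' : x = 0 := hx
  subst hx'
  have h' : Tendsto (fun t : ℝ => (t : ℂ)⁻¹ • (G t (0 : E) - 0)) (𝓝[≠] 0) (𝓝 y) := h
  simp only [map_zero, sub_zero, smul_zero] at h'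
  exact tendsto_nhds_unique h' tendsto_const_nhds

end UnboundedOp

/-! ### Functions on the half line -/

namespace HalfLine

variable (X : Type*) [NormedAddCommGroup X] [NormedSpace ℂ X]

/-- `BUC(ℝ⁺, X)`: bounded uniformly continuous functions on `[0, ∞)`, with the sup-norm. -/
def BUC : Submodule ℂ (ℝ≥0 →ᵇ X) where
  carrier := {f | UniformContinuous f}
  zero_mem' := uniformContinuous_const
  add_mem' := fun {_ _} hf hg => UniformContinuous.add hf hg
  smul_mem' := fun c _ hf => UniformContinuous.const_smul hf c

/-- `C₀(ℝ⁺, X)`: the elements of `BUC(ℝ⁺, X)` that tend to `0` at infinity. -/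
def C0 : Submodule ℂ (BUC X) where
  carrier := {f | Tendsto (fun t : ℝ≥0 => f.1 t) atTop (𝓝 0)}
  zero_mem' := tendsto_const_nhds
  add_mem' := by
    intro f g hf hg
    simpa using Tendsto.add hf hg
  smul_mem' := by
    intro c f hf
    simpa using Tendsto.const_smul hf c

instance isClosed_C0 : IsClosed (C0 X : Set (BUC X)) := by
  rw [← isSeqClosed_iff_isClosed]
  intro u f hu hf
  have hunif : TendstoUniformly (fun n (t : ℝ≥0) => (u n).1 t) (fun t => f.1 t) atTop :=
    BoundedContinuousFunction.tendsto_iff_tendstoUniformly.1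
      ((continuous_subtype_val.tendsto f).comp hf)
  rw [Metric.tendstoUniformly_iff] at hunif
  change Tendsto (fun t : ℝ≥0 => f.1 t) atTop (𝓝 0)
  rw [Metric.tendsto_nhds]
  intro ε hε
  obtain ⟨n, hn⟩ := (hunif (ε / 2) (half_pos hε)).exists
  filter_upwards [Metric.tendsto_nhds.1 (show Tendsto (fun t : ℝ≥0 => (u n).1 t) atTop (𝓝 0)
    from hu n) (ε / 2) (half_pos hε)] with t ht
  calc dist (f.1 t) 0 ≤ dist (f.1 t) ((u n).1 t) + dist ((u n).1 t) 0 := dist_triangle _ _ _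
    _ < ε / 2 + ε / 2 := add_lt_add (hn t) ht
    _ = ε := add_halves ε

/-- The quotient space `Y = BUC(ℝ⁺, X) / C₀(ℝ⁺, X)`. -/
def Y : Type _ := BUC X ⧸ C0 X

/-- The quotient norm on `Y`. -/
instance instNormedAddCommGroupY : NormedAddCommGroup (Y X) :=
  inferInstanceAs (NormedAddCommGroup (BUC X ⧸ C0 X))

instance instNormedSpaceY : NormedSpace ℂ (Y X) :=
  inferInstanceAs (NormedSpace ℂ (BUC X ⧸ C0 X))

variable {X}

/-- The quotient map `f ↦ f̃` from `BUC(ℝ⁺, X)` to `Y`. -/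
def cls : BUC X →L[ℂ] Y X := (C0 X).mkQL

theorem cls_surjective : Function.Surjective (cls : BUC X →L[ℂ] Y X) := (C0 X).mkQ_surjective

theorem cls_eq_zero {f : BUC X} : cls f = 0 ↔ f ∈ C0 X := Submodule.Quotient.mk_eq_zero (C0 X)

/-! ### The differentiation operator and the operator it induces on the quotient -/

variable (X) in
/-- The graph of `d/dt` in `BUC(ℝ⁺, X)`: the pairs `(f, g)` with `f' = g` on `[0, ∞)` (a one-sided
derivative at `0`). -/
def derivGraph : Submodule ℂ (BUC X × BUC X) where
  carrier := {p | ∀ t : ℝ≥0,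
    HasDerivWithinAt (fun s : ℝ => p.1.1 s.toNNReal) (p.2.1 t) (Ici 0) (t : ℝ)}
  zero_mem' := fun _ => hasDerivWithinAt_const _ _ _
  add_mem' := fun hp hq t => (hp t).add (hq t)
  smul_mem' := fun c _ hp t => (hp t).const_smul c

variable (X) in
/-- The differentiation operator `𝒟 = d/dt` in `BUC(ℝ⁺, X)`, with domain the set of `f` that have
a derivative `f' ∈ BUC(ℝ⁺, X)`. -/
def opD : BUC X →ₗ.[ℂ] BUC X := (derivGraph X).toLinearPMap

variable (X) in
/-- The graph of the operator induced by `𝒟` on `Y`: the pairs `(ũ, class of 𝒟 u)`,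
`u ∈ D(𝒟)`. -/
def quotDerivGraph : Submodule ℂ (Y X × Y X) :=
  (opD X).graph.map (cls.toLinearMap.prodMap cls.toLinearMap)

variable (X) in
/-- The operator `𝒟̃` on `Y`: its domain is `{f̃ : ∃ u ∈ f̃, u ∈ D(𝒟)}`, and `𝒟̃ f̃` is the class
of `𝒟 u`. -/
def opDQ : Y X →ₗ.[ℂ] Y X := (quotDerivGraph X).toLinearPMap

theorem opD_graph : (opD X).graph = derivGraph X := by
  refine Submodule.toLinearPMap_graph_eq _ ?_
  rintro ⟨f, g⟩ h hf
  have hf' : f = 0 := hf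
  subst hf'
  refine Subtype.ext (BoundedContinuousFunction.ext fun t => ?_)
  exact (uniqueDiffOn_Ici (0 : ℝ) t t.2).eq_deriv _ (h t) (hasDerivWithinAt_const _ _ _)

/-- If `f → 0` at infinity and `f'` is uniformly continuous, then `f' → 0` at infinity. -/
theorem deriv_mem_C0 {f g : BUC X} (h : (f, g) ∈ derivGraph X) (hf : f ∈ C0 X) : g ∈ C0 X := by
  have hf' : Tendsto (fun t : ℝ≥0 => f.1 t) atTop (𝓝 0) := hf
  have hg : UniformContinuous g.1 := g.2
  change Tendsto (fun t : ℝ≥0 => g.1 t) atTop (𝓝 0)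
  rw [Metric.tendsto_nhds]
  intro ε hε
  obtain ⟨δ, hδ, hgδ⟩ := Metric.uniformContinuous_iff.1 hg (ε / 2) (half_pos hε)
  let d : ℝ≥0 := ⟨δ / 2, (half_pos hδ).le⟩
  have hd : (d : ℝ) = δ / 2 := rfl
  have hd0 : 0 < (d : ℝ) := half_pos hδ
  have hshift : Tendsto (fun t : ℝ≥0 => f.1 (t + d) - f.1 t) atTop (𝓝 0) := by
    have h1 : Tendsto (fun t : ℝ≥0 => t + d) atTop atTop :=
      tendsto_atTop_mono (fun _ => le_self_add) tendsto_id
    have h2 := (hf'.comp h1).sub hf'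
    rw [sub_zero] at h2
    exact h2
  filter_upwards [Metric.tendsto_nhds.1 hshift (d * (ε / 2)) (by positivity)] with t ht
  rw [dist_zero_right] at ht ⊢
  have hder : ∀ s ∈ Icc (t : ℝ) (t + d), HasDerivWithinAt
      (fun r : ℝ => f.1 r.toNNReal - r • g.1 t) (g.1 s.toNNReal - (1 : ℝ) • g.1 t)
      (Icc (t : ℝ) (t + d)) s := by
    intro s hs
    have hs0 : 0 ≤ s := t.2.trans hs.1
    have h1 := h s.toNNReal
    rw [Real.coe_toNNReal s hs0] at h1
    exact (h1.mono fun r hr => t.2.trans hr.1).sub ((hasDerivWithinAt_id _ _).smul_const _)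
  have hbd : ∀ s ∈ Icc (t : ℝ) (t + d), ‖g.1 s.toNNReal - (1 : ℝ) • g.1 t‖ ≤ ε / 2 := by
    intro s hs
    have hs0 : 0 ≤ s := t.2.trans hs.1
    rw [one_smul, ← dist_eq_norm]
    refine (hgδ ?_).le
    rw [NNReal.dist_eq, Real.coe_toNNReal s hs0, abs_of_nonneg (by linarith [hs.1])]
    linarith [hs.2]
  have key := (convex_Icc (t : ℝ) (t + d)).norm_image_sub_le_of_norm_hasDerivWithin_le hder hbd
    (left_mem_Icc.2 (by linarith)) (right_mem_Icc.2 (by linarith))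
  rw [← NNReal.coe_add, Real.toNNReal_coe, Real.toNNReal_coe, NNReal.coe_add, add_sub_cancel_left,
    Real.norm_of_nonneg hd0.le] at key
  have hsplit : (d : ℝ) • g.1 t = (f.1 (t + d) - f.1 t) -
      (f.1 (t + d) - ((t : ℝ) + d) • g.1 t - (f.1 t - (t : ℝ) • g.1 t)) := by
    rw [add_smul]; abel
  have hn : (d : ℝ) * ‖g.1 t‖ < d * ε := by
    calc (d : ℝ) * ‖g.1 t‖ = ‖(d : ℝ) • g.1 t‖ := by rw [norm_smul, Real.norm_of_nonneg hd0.le]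
      _ ≤ _ := by rw [hsplit]; exact norm_sub_le _ _
      _ < d * (ε / 2) + ε / 2 * d := add_lt_add_of_lt_of_le ht key
      _ = d * ε := by ring
  exact lt_of_mul_lt_mul_left hn hd0.le

/-- `𝒟̃` is well defined: `quotDerivGraph` is the graph of a single-valued operator. -/
theorem opDQ_graph : (opDQ X).graph = quotDerivGraph X := by
  refine Submodule.toLinearPMap_graph_eq _ ?_
  rintro ⟨a, b⟩ h ha
  obtain ⟨⟨f, g⟩, hfg, he⟩ := h
  have ha' : a = 0 := ha
  obtain ⟨h1, h2⟩ := Prod.ext_iff.1 he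
  have hf : f ∈ C0 X := cls_eq_zero.1 (h1.trans ha')
  have hfg' : (f, g) ∈ derivGraph X := by rw [← opD_graph]; exact hfg
  exact h2.symm.trans (cls_eq_zero.2 (deriv_mem_C0 hfg' hf))

/-! ### The spectrum of a function -/

/-- The transform `f̂(z) = (z - 𝒟̃)⁻¹ f̃`, defined for `z ∈ ρ(𝒟̃)`. -/
def transform (f : BUC X) (z : ℂ) : Y X := UnboundedOp.resolvent (opDQ X) z (cls f)

/-- `sp(f)`: the set of real `ξ` such that `f̂` (a function on `ρ(𝒟̃)`) has no analytic extension
to any neighborhood of `iξ`. -/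
def sp (f : BUC X) : Set ℝ :=
  {ξ | ¬ ∃ U : Set ℂ, IsOpen U ∧ Complex.I * ξ ∈ U ∧ ∃ G : ℂ → Y X, AnalyticOnNhd ℂ G U ∧
    ∀ z ∈ U ∩ UnboundedOp.resolventSet (opDQ X), G z = transform f z}

/-! ### The translation group on the quotient -/

/-- Translation of a function by `t ∈ ℝ`. For `t ≥ 0` this is `(S(t) f)(s) = f(s + t)`. For `t < 0`
it is the right shift, with the initial gap `[0, -t]` filled by the constant `f 0`; modulo `C₀` it
is the inverse of `S(-t)`. -/
def shift (t : ℝ) : BUC X →L[ℂ] BUC X :=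
  LinearMap.mkContinuous
    { toFun := fun f =>
        ⟨BoundedContinuousFunction.compContinuous f.1
          ⟨fun s : ℝ≥0 => ((s : ℝ) + t).toNNReal, by fun_prop⟩, by
          have h : UniformContinuous (fun s : ℝ≥0 => ((s : ℝ) + t).toNNReal) :=
            Real.lipschitzWith_toNNReal.uniformContinuous.comp
              (UniformContinuous.add uniformContinuous_subtype_val uniformContinuous_const)
          exact UniformContinuous.comp f.2 h⟩
      map_add' := fun _ _ => rfl
      map_smul' := fun _ _ => rfl }
    1 (fun f => by
      rw [one_mul]
      exact (BoundedContinuousFunction.norm_le (norm_nonneg _)).2 fun s =>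
        BoundedContinuousFunction.norm_coe_le_norm f.1 _)

theorem shift_apply (t : ℝ) (f : BUC X) (s : ℝ≥0) :
    (shift t f).1 s = f.1 ((s : ℝ) + t).toNNReal := rfl

theorem shift_apply_of_nonneg (t : ℝ≥0) (f : BUC X) (s : ℝ≥0) :
    (shift (t : ℝ) f).1 s = f.1 (s + t) := by
  rw [shift_apply, ← NNReal.coe_add, Real.toNNReal_coe]

theorem C0_le_comap_shift (t : ℝ) : C0 X ≤ (C0 X).comap (shift t).toLinearMap := by
  intro f hf
  have hf' : Tendsto (fun s : ℝ≥0 => f.1 s) atTop (𝓝 0) := hf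
  change Tendsto (fun s : ℝ≥0 => f.1 ((s : ℝ) + t).toNNReal) atTop (𝓝 0)
  refine hf'.comp (tendsto_real_toNNReal_atTop.comp (tendsto_atTop_add_const_right _ _ ?_))
  exact NNReal.tendsto_coe_atTop.2 tendsto_id

/-- The operator `S̃(t)`, `t ∈ ℝ`, induced on `Y` by translation. -/
def shiftQ (t : ℝ) : Y X →L[ℂ] Y X := (C0 X).liftQL (cls.comp (shift t)) fun _ hf =>
    cls_eq_zero.2 (C0_le_comap_shift t hf)

theorem shiftQ_cls (t : ℝ) (f : BUC X) : shiftQ t (cls f) = cls (shift t f) := rfl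

/-- `(S̃(t))` is a one-parameter group; in particular `S̃(-t)` is the inverse of `S̃(t)`. -/
theorem shiftQ_add (s t : ℝ) (y : Y X) : shiftQ (s + t) y = shiftQ s (shiftQ t y) := by
  obtain ⟨f, rfl⟩ := cls_surjective y
  rw [shiftQ_cls, shiftQ_cls, shiftQ_cls, ← sub_eq_zero, ← map_sub, cls_eq_zero]
  change Tendsto (fun r : ℝ≥0 => f.1 ((r : ℝ) + (s + t)).toNNReal -
    f.1 ((((r : ℝ) + s).toNNReal : ℝ) + t).toNNReal) atTop (𝓝 0)
  refine tendsto_const_nhds.congr' ?_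
  filter_upwards [eventually_ge_atTop (-s).toNNReal] with r hr
  have hr' : -s ≤ r := Real.toNNReal_le_iff_le_coe.1 hr
  rw [Real.coe_toNNReal _ (by linarith), add_assoc, sub_self]

theorem shiftQ_zero (y : Y X) : shiftQ 0 y = y := by
  obtain ⟨f, rfl⟩ := cls_surjective y
  have h : shift 0 f = f := Subtype.ext (BoundedContinuousFunction.ext fun s =>
    (shift_apply 0 f s).trans (by rw [add_zero, Real.toNNReal_coe]))
  rw [shiftQ_cls, h]

/-! ### The closed translation-invariant subspace generated by `f` -/

/-- `M_f`: the closed linear span in `Y` of `{S̃(t) f̃ : t ∈ ℝ}`. -/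
def orbitSpan (f : BUC X) : Submodule ℂ (Y X) :=
  (Submodule.span ℂ (range fun t : ℝ => shiftQ t (cls f))).topologicalClosure

theorem shiftQ_mem_orbitSpan (f : BUC X) (t : ℝ) {y : Y X} (hy : y ∈ orbitSpan f) :
    shiftQ t y ∈ orbitSpan f := by
  refine map_mem_closure (shiftQ t).continuous hy fun z hz => ?_
  have hz' : z ∈ Submodule.span ℂ (range fun t : ℝ => shiftQ t (cls f)) := hz
  change shiftQ t z ∈ Submodule.span ℂ (range fun t : ℝ => shiftQ t (cls f))
  induction hz' using Submodule.span_induction with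
  | mem x hx =>
    obtain ⟨s, rfl⟩ := hx
    exact Submodule.subset_span ⟨t + s, shiftQ_add t s _⟩
  | zero => rw [map_zero]; exact Submodule.zero_mem _
  | add x y hx hy h1 h2 => rw [map_add]; exact Submodule.add_mem _ (h1 hx) (h2 hy)
  | smul c x hx h1 => rw [map_smul]; exact Submodule.smul_mem _ c (h1 hx)

/-- The restriction of `S̃(t)` to `M_f`. -/
def shiftOn (f : BUC X) (t : ℝ) : orbitSpan f →L[ℂ] orbitSpan f :=
  ((shiftQ t).comp (orbitSpan f).subtypeL).codRestrict (orbitSpan f)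
    fun y => shiftQ_mem_orbitSpan f t y.2

/-- `𝒟̃|_{M_f}`: the infinitesimal generator of the group `(S̃(t)|_{M_f})`, `t ∈ ℝ`. -/
def genOn (f : BUC X) : orbitSpan f →ₗ.[ℂ] orbitSpan f := UnboundedOp.generator (shiftOn f)

end HalfLine

end

/-! Translations act on the quotient as a strongly continuous group of isometries whose generator is
`opDQ` (`opDQ_eq_generator`). Its resolvent, and that of the restriction `genOn f`, therefore exists
off the imaginary axis with norm at most `1 / |Re z|`. Where both resolvents exist, that of `genOn
f` is the restriction of that of `opDQ` (`coe_resolvent_genOn`).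

If `iξ` is a resolvent point of `genOn f`, the restricted resolvent applied to the class of `f` is
an analytic extension of the transform.

Conversely, suppose the transform extends to a disc about `iξ`. Translations commute with the
resolvent, so the local resolvents of all `g` in the span of the orbit extend to the same disc. Each
extension is bounded by `‖g‖ / |Re w|` off the axis. The maximum principle, with a factor that
cancels this singularity on the circle, gives a bound `2‖g‖ / r` near the centre that does not
depend on the extension (`norm_le_of_norm_le_div_abs_re`). By density it bounds the resolvent of
`genOn f` so close to `iξ` that the Neumann series reaches `iξ`. -/

noncomputable section

namespace UnboundedOp

open MeasureTheory

variable {E : Type*} [NormedAddCommGroup E] [NormedSpace ℂ E]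

/-! ### Resolvents: Neumann series and analyticity -/

theorem isResolvent_iff_graph {T : E →ₗ.[ℂ] E} {z : ℂ} {R : E →L[ℂ] E} :
    IsResolvent T z R ↔ (∀ y, (R y, z • R y - y) ∈ T.graph) ∧
      ∀ x y, (x, y) ∈ T.graph → R (z • x - y) = x := by
  constructor
  · rintro ⟨h1, h2⟩
    refine ⟨fun y => ?_, fun x y hxy => ?_⟩
    · obtain ⟨x, hx, hxy⟩ := h1 y
      refine (LinearPMap.mem_graph_iff T).2 ⟨x, hx, ?_⟩
      rw [← hx, ← hxy, sub_sub_cancel]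
    · obtain ⟨a, rfl, rfl⟩ := (LinearPMap.mem_graph_iff T).1 hxy
      exact h2 a
  · rintro ⟨h1, h2⟩
    refine ⟨fun y => ?_, fun x => h2 _ _ (T.mem_graph x)⟩
    obtain ⟨a, ha, hb⟩ := (LinearPMap.mem_graph_iff T).1 (h1 y)
    refine ⟨a, ha, ?_⟩
    simp only at ha hb
    rw [hb, ha, sub_sub_cancel]

theorem resolvent_eq {T : E →ₗ.[ℂ] E} {z : ℂ} {R : E →L[ℂ] E} (h : IsResolvent T z R) :
    resolvent T z = R :=
  (isResolvent_resolvent ⟨R, h⟩).unique h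

/-- Neumann series: a perturbation `w` of a point `z` of the resolvent set, with
`V = (1 - (z - w) R(z))⁻¹`. -/
theorem IsResolvent.comp_inverse {T : E →ₗ.[ℂ] E} {z w : ℂ} {R V : E →L[ℂ] E}
    (h : IsResolvent T z R) (hl : V * (1 - (z - w) • R) = 1) (hr : (1 - (z - w) • R) * V = 1) :
    IsResolvent T w (R * V) := by
  rw [isResolvent_iff_graph] at h ⊢
  obtain ⟨h1, h2⟩ := h
  -- `V` inverts a polynomial in `R`, hence commutes with `R`; the left-inverse half needs the order
  -- `V * R`.
  have hcomm : R * V = V * R := by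
    have hR : (1 - (z - w) • R) * R = R * (1 - (z - w) • R) := by
      simp [sub_mul, mul_sub]
    calc R * V = V * (1 - (z - w) • R) * (R * V) := by rw [hl, one_mul]
      _ = V * (((1 - (z - w) • R) * R) * V) := by simp only [mul_assoc]
      _ = V * R * ((1 - (z - w) • R) * V) := by rw [hR]; simp only [mul_assoc]
      _ = V * R := by rw [hr, mul_one]
  constructor
  · intro y
    have e := h1 (V y)
    have e2 : V y - (z - w) • R (V y) = y := by
      simpa using DFunLike.congr_fun hr y
    have e3 : w • R (V y) - y = z • R (V y) - V y := by
      nth_rw 2 [← e2]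
      module
    change (R (V y), w • R (V y) - y) ∈ T.graph
    rwa [e3]
  · intro x y hxy
    have e := h2 x y hxy
    have e2 : V (x - (z - w) • R x) = x := by simpa using DFunLike.congr_fun hl x
    rw [hcomm]
    change V (R (w • x - y)) = x
    have e3 : R (w • x - y) = R (z • x - y) - (z - w) • R x := by
      simp only [map_sub, map_smul]
      module
    rw [e3, e, e2]

theorem isResolvent_of_norm_lt [CompleteSpace E] {T : E →ₗ.[ℂ] E} {z w : ℂ} {R : E →L[ℂ] E}
    (h : IsResolvent T z R) (hw : ‖(z - w) • R‖ < 1) :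
    IsResolvent T w (R * Ring.inverse (1 - (z - w) • R)) := by
  have hu := isUnit_one_sub_of_norm_lt_one hw
  exact h.comp_inverse (Ring.inverse_mul_cancel _ hu) (Ring.mul_inverse_cancel _ hu)

theorem eventually_isResolvent [CompleteSpace E] {T : E →ₗ.[ℂ] E} {z : ℂ} {R : E →L[ℂ] E}
    (h : IsResolvent T z R) :
    ∀ᶠ w in 𝓝 z, IsResolvent T w (R * Ring.inverse (1 - (z - w) • R)) := by
  have hc : Continuous fun w : ℂ => ‖(z - w) • R‖ := by fun_prop
  have := hc.tendsto z
  simp only [sub_self, zero_smul, norm_zero] at this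
  filter_upwards [this.eventually (gt_mem_nhds one_pos)] with w hw
  exact isResolvent_of_norm_lt h hw

theorem isOpen_resolventSet [CompleteSpace E] (T : E →ₗ.[ℂ] E) : IsOpen (resolventSet T) := by
  rw [isOpen_iff_mem_nhds]
  rintro z ⟨R, h⟩
  filter_upwards [eventually_isResolvent h] with w hw using ⟨_, hw⟩

/-- Near `z` the resolvent is given by the Neumann formula, and inversion in a Banach algebra is
analytic at the unit `1`. -/
theorem analyticOnNhd_resolvent [CompleteSpace E] (T : E →ₗ.[ℂ] E) :
    AnalyticOnNhd ℂ (resolvent T) (resolventSet T) := by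
  rintro z ⟨R, h⟩
  have h1 : AnalyticAt ℂ (fun w : ℂ => R * Ring.inverse (1 - (z - w) • R)) z := by
    refine analyticAt_const.mul ?_
    refine AnalyticAt.fun_comp (f := fun w : ℂ => 1 - (z - w) • R) (g := Ring.inverse) ?_ ?_
    · simp only [sub_self, zero_smul, sub_zero]
      exact analyticAt_inverse (𝕜 := ℂ) (1 : (E →L[ℂ] E)ˣ)
    · exact analyticAt_const.sub ((analyticAt_const.sub analyticAt_id).smul analyticAt_const)
  refine h1.congr ?_
  filter_upwards [eventually_isResolvent h] with w hw using (resolvent_eq hw).symm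

/-! ### Generators of contraction groups and their Laplace transforms -/

/-- A strongly continuous one-parameter group of contractions (hence of isometries). -/
structure IsContractionGroup (G : ℝ → E →L[ℂ] E) : Prop where
  map_zero : ∀ x, G 0 x = x
  map_add : ∀ s t x, G (s + t) x = G s (G t x)
  norm_le : ∀ t x, ‖G t x‖ ≤ ‖x‖
  tendsto_zero : ∀ x, Tendsto (fun t => G t x) (𝓝 0) (𝓝 x)

theorem mem_generator_graph_iff {G : ℝ → E →L[ℂ] E} (h0 : ∀ x, G 0 x = x) {x y : E} :
    (x, y) ∈ (generator G).graph ↔ HasDerivAt (fun t => G t x) y 0 := by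
  rw [generator_graph, hasDerivAt_iff_tendsto_slope_zero]
  change Tendsto (fun t : ℝ => (t : ℂ)⁻¹ • (G t x - x)) (𝓝[≠] 0) (𝓝 y) ↔ _
  refine tendsto_congr fun t => ?_
  rw [zero_add, h0, ← Complex.ofReal_inv, Complex.coe_smul]

namespace IsContractionGroup

variable {G : ℝ → E →L[ℂ] E}

theorem continuous (hG : IsContractionGroup G) (x : E) : Continuous fun t => G t x := by
  rw [continuous_iff_continuousAt]
  intro t
  have h1 : Tendsto (fun s => G t (G (s - t) x)) (𝓝 t) (𝓝 (G t x)) := by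
    refine ((G t).continuous.tendsto x).comp ((hG.tendsto_zero x).comp ?_)
    have : Continuous fun s : ℝ => s - t := by fun_prop
    simpa using this.tendsto t
  refine h1.congr fun s => ?_
  rw [← hG.map_add, add_sub_cancel]

theorem neg (hG : IsContractionGroup G) : IsContractionGroup fun t => G (-t) where
  map_zero x := by rw [neg_zero, hG.map_zero]
  map_add s t x := by rw [neg_add, hG.map_add]
  norm_le t x := hG.norm_le _ x
  tendsto_zero x := by
    have h := (hG.tendsto_zero x).comp (continuous_neg.tendsto' (0 : ℝ) 0 neg_zero)
    exact h

theorem mem_graph_neg_iff (hG : IsContractionGroup G) {x y : E} :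
    (x, y) ∈ (generator fun t => G (-t)).graph ↔ (x, -y) ∈ (generator G).graph := by
  rw [mem_generator_graph_iff hG.neg.map_zero, mem_generator_graph_iff hG.map_zero]
  constructor <;> intro h
  · have := (HasDerivAt.scomp_of_eq (0 : ℝ) h (hasDerivAt_neg (0 : ℝ)) (by simp))
    simpa [Function.comp_def] using this
  · have := (HasDerivAt.scomp_of_eq (0 : ℝ) h (hasDerivAt_neg (0 : ℝ)) (by simp))
    simpa [Function.comp_def] using this

/-- The group law `G s x = G t (G (s - t) x)` transports the derivative at `0` to every time. -/
theorem hasDerivAt (hG : IsContractionGroup G) {x y : E} (h : (x, y) ∈ (generator G).graph)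
    (t : ℝ) : HasDerivAt (fun t => G t x) (G t y) t := by
  rw [mem_generator_graph_iff hG.map_zero] at h
  have h1 : HasDerivAt (fun s => G (s - t) x) y t := by
    have := HasDerivAt.comp_sub_const t t (f := fun t => G t x) (f' := y) (by simpa using h)
    exact this
  have h2 := ((G t).restrictScalars ℝ).hasFDerivAt.comp_hasDerivAt t h1
  refine (h2.congr_of_eventuallyEq (Eventually.of_forall fun s => ?_))
  change G s x = G t (G (s - t) x)
  rw [← hG.map_add, add_sub_cancel]

/-- The integrand of the Laplace transform of an orbit. -/
def laplaceIntegrand (G : ℝ → E →L[ℂ] E) (z : ℂ) (y : E) (t : ℝ) : E :=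
  Complex.exp (-z * t) • G t y

theorem norm_laplaceIntegrand_le (hG : IsContractionGroup G) (z : ℂ) (y : E) (t : ℝ) :
    ‖laplaceIntegrand G z y t‖ ≤ ‖y‖ * Real.exp (-z.re * t) := by
  rw [laplaceIntegrand, norm_smul, Complex.norm_exp, mul_comm]
  have : (-z * (t : ℂ)).re = -z.re * t := by simp
  rw [this]
  gcongr
  exact hG.norm_le t y

theorem continuous_laplaceIntegrand (hG : IsContractionGroup G) (z : ℂ) (y : E) :
    Continuous (laplaceIntegrand G z y) := by
  have := hG.continuous y
  unfold laplaceIntegrand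
  fun_prop

theorem integrableOn_bound {a : ℝ} (ha : 0 < a) (c b : ℝ) :
    IntegrableOn (fun t : ℝ => c * Real.exp (-a * t)) (Ioi b) :=
  (integrableOn_exp_mul_Ioi (by linarith) b).const_mul c

theorem integrableOn_laplaceIntegrand (hG : IsContractionGroup G) {z : ℂ} (hz : 0 < z.re) (y : E)
    (b : ℝ) : IntegrableOn (laplaceIntegrand G z y) (Ioi b) := by
  refine Integrable.mono' (integrableOn_bound hz ‖y‖ b)
    (hG.continuous_laplaceIntegrand z y).aestronglyMeasurable ?_
  exact Eventually.of_forall fun t => hG.norm_laplaceIntegrand_le z y t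

/-- The Laplace transform of a contraction group. -/
def laplace (hG : IsContractionGroup G) {z : ℂ} (hz : 0 < z.re) : E →L[ℂ] E :=
  LinearMap.mkContinuous
    { toFun := fun y => ∫ t in Ioi (0 : ℝ), laplaceIntegrand G z y t
      map_add' := fun x y => by
        rw [← integral_add (hG.integrableOn_laplaceIntegrand hz x 0)
          (hG.integrableOn_laplaceIntegrand hz y 0)]
        simp [laplaceIntegrand]
      map_smul' := fun c y => by
        rw [RingHom.id_apply, ← integral_smul]
        simp [laplaceIntegrand, smul_comm c] }
    (1 / z.re) (fun y => by
      refine (norm_integral_le_of_norm_le (integrableOn_bound hz ‖y‖ 0)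
        (Eventually.of_forall fun t => hG.norm_laplaceIntegrand_le z y t)).trans_eq ?_
      rw [integral_const_mul, integral_exp_mul_Ioi (by linarith)]
      simp
      ring)

theorem laplace_apply (hG : IsContractionGroup G) {z : ℂ} (hz : 0 < z.re) (y : E) :
    hG.laplace hz y = ∫ t in Ioi (0 : ℝ), laplaceIntegrand G z y t := rfl

theorem norm_laplace_le (hG : IsContractionGroup G) {z : ℂ} (hz : 0 < z.re) :
    ‖hG.laplace hz‖ ≤ 1 / z.re :=
  LinearMap.mkContinuous_norm_le _ (by positivity) _

/-- A change of variable in the Laplace integral. The right side is differentiable in `h` even when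
the orbit of `y` is not, which puts the Laplace transform into the domain of the generator. -/
theorem apply_laplace [CompleteSpace E] (hG : IsContractionGroup G) {z : ℂ} (hz : 0 < z.re)
    (y : E) (h : ℝ) : G h (hG.laplace hz y) =
      Complex.exp (z * h) • (hG.laplace hz y - ∫ t in (0 : ℝ)..h, laplaceIntegrand G z y t) := by
  have e1 : ∫ t in Ioi (0 : ℝ), laplaceIntegrand G z y (t + h) =
      hG.laplace hz y - ∫ t in (0 : ℝ)..h, laplaceIntegrand G z y t := by
    have e2 : ∫ t in Ioi (0 : ℝ), laplaceIntegrand G z y (t + h) =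
        ∫ t in Ioi h, laplaceIntegrand G z y t := by
      have e3 := (measurePreserving_add_right volume h).setIntegral_preimage_emb
        (measurableEmbedding_addRight h) (laplaceIntegrand G z y) (Ioi h)
      simpa using e3
    rw [e2, laplace_apply, eq_sub_iff_add_eq, add_comm]
    exact intervalIntegral.integral_interval_add_Ioi (hG.integrableOn_laplaceIntegrand hz y 0)
      (hG.integrableOn_laplaceIntegrand hz y h)
  rw [← e1, laplace_apply, ← (G h).integral_comp_comm (hG.integrableOn_laplaceIntegrand hz y 0),
    ← integral_smul]
  congr 1
  ext t
  simp only [laplaceIntegrand, map_smul, smul_smul, ← Complex.exp_add]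
  rw [← hG.map_add, add_comm h t]
  congr 2
  push_cast
  ring

/-- The right inverse comes from differentiating `apply_laplace` at `h = 0`. For the left inverse,
the integrand for `z • x - y` is the derivative of `-exp (-z t) • G t x`, which vanishes at
infinity. -/
theorem isResolvent_laplace [CompleteSpace E] (hG : IsContractionGroup G) {z : ℂ}
    (hz : 0 < z.re) : IsResolvent (generator G) z (hG.laplace hz) := by
  rw [isResolvent_iff_graph]
  constructor
  · intro y
    rw [mem_generator_graph_iff hG.map_zero]
    have h1 : HasDerivAt (fun h : ℝ => Complex.exp (z * h)) z 0 := by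
      have h := ((Complex.ofRealCLM.hasDerivAt (x := (0 : ℝ))).const_mul z).cexp
      simpa using h
    have h2 : HasDerivAt (fun h : ℝ => hG.laplace hz y - ∫ t in (0 : ℝ)..h, laplaceIntegrand G z y t)
        (-y) 0 := by
      have h := (hG.continuous_laplaceIntegrand z y).integral_hasStrictDerivAt 0 0
      have h' := h.hasDerivAt.const_sub (hG.laplace hz y)
      simpa [laplaceIntegrand, hG.map_zero] using h'
    have h3 := h1.smul h2
    simp only [intervalIntegral.integral_same, Complex.ofReal_zero, mul_zero, Complex.exp_zero,
      one_smul, sub_zero] at h3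
    rw [neg_add_eq_sub] at h3
    exact h3.congr_of_eventuallyEq (Eventually.of_forall fun t => hG.apply_laplace hz y t)
  · intro x y hxy
    have hd : ∀ t ∈ Ici (0 : ℝ), HasDerivAt (fun t => -laplaceIntegrand G z x t)
        (laplaceIntegrand G z (z • x - y) t) t := by
      intro t _
      have h1 : HasDerivAt (fun h : ℝ => Complex.exp (-z * h)) (Complex.exp (-z * t) * (-z)) t := by
        have h := ((Complex.ofRealCLM.hasDerivAt (x := t)).const_mul (-z)).cexp
        simpa using h
      have h2 := (h1.smul (hG.hasDerivAt hxy t)).neg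
      refine h2.congr_deriv ?_
      simp only [laplaceIntegrand, map_sub, map_smul]
      module
    have hl : Tendsto (fun t => -laplaceIntegrand G z x t) atTop (𝓝 0) := by
      rw [tendsto_zero_iff_norm_tendsto_zero]
      refine squeeze_zero (fun _ => norm_nonneg _)
        (fun t => (norm_neg _).trans_le (hG.norm_laplaceIntegrand_le z x t)) ?_
      have h := (Real.tendsto_exp_neg_atTop_nhds_zero.comp
        (tendsto_id.const_mul_atTop hz)).const_mul ‖x‖
      simpa [Function.comp_def] using h
    rw [laplace_apply, integral_Ioi_of_hasDerivAt_of_tendsto' hd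
      (hG.integrableOn_laplaceIntegrand hz _ 0) hl]
    simp [laplaceIntegrand, hG.map_zero]

theorem exists_isResolvent [CompleteSpace E] (hG : IsContractionGroup G) {z : ℂ}
    (hz : z.re ≠ 0) : ∃ R, IsResolvent (generator G) z R ∧ ‖R‖ ≤ 1 / |z.re| := by
  -- In the left half-plane time is reversed: the generator changes sign, and minus the Laplace
  -- transform at `-z` is the resolvent.
  rcases hz.lt_or_gt with hz | hz
  · have hz' : 0 < (-z).re := by simpa using hz
    have h := hG.neg.isResolvent_laplace hz'
    refine ⟨-hG.neg.laplace hz', ?_, ?_⟩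
    · rw [isResolvent_iff_graph] at h ⊢
      constructor
      · intro y
        have := (generator G).graph.neg_mem (hG.mem_graph_neg_iff.1 (h.1 y))
        rw [Prod.neg_mk, neg_neg] at this
        rwa [neg_apply, smul_neg, ← neg_smul]
      · intro x y hxy
        have := h.2 x (-y) (hG.mem_graph_neg_iff.2 (by simpa using hxy))
        rw [neg_apply, ← map_neg]
        convert this using 2
        module
    · rw [norm_neg, abs_of_neg hz]
      simpa using hG.neg.norm_laplace_le hz'
  · exact ⟨_, hG.isResolvent_laplace hz, by simpa [abs_of_pos hz] using hG.norm_laplace_le hz⟩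

theorem norm_resolvent_le [CompleteSpace E] (hG : IsContractionGroup G) {z : ℂ}
    (hz : z.re ≠ 0) : ‖resolvent (generator G) z‖ ≤ 1 / |z.re| := by
  obtain ⟨R, hR, hn⟩ := hG.exists_isResolvent hz
  rwa [resolvent_eq hR]

theorem mem_resolventSet [CompleteSpace E] (hG : IsContractionGroup G) {z : ℂ}
    (hz : z.re ≠ 0) : z ∈ resolventSet (generator G) :=
  let ⟨R, hR, _⟩ := hG.exists_isResolvent hz
  ⟨R, hR⟩

theorem map_mem_graph (hG : IsContractionGroup G) (t : ℝ) {x y : E}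
    (h : (x, y) ∈ (generator G).graph) : (G t x, G t y) ∈ (generator G).graph := by
  rw [mem_generator_graph_iff hG.map_zero]
  have h1 := HasDerivAt.comp_add_const (0 : ℝ) t (hG.hasDerivAt h (0 + t))
  simpa only [hG.map_add, zero_add] using h1

end IsContractionGroup

end UnboundedOp

namespace HalfLine

open MeasureTheory UnboundedOp

variable {X : Type*} [NormedAddCommGroup X] [NormedSpace ℂ X]

/-! ### Completeness, and the translation group on the quotient -/

instance completeSpace_BUC [CompleteSpace X] : CompleteSpace (BUC X) := by
  have h : IsClosed (BUC X : Set (ℝ≥0 →ᵇ X)) := by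
    rw [← isSeqClosed_iff_isClosed]
    intro u f hu hf
    exact (BoundedContinuousFunction.tendsto_iff_tendstoUniformly.1 hf).uniformContinuous
      (Frequently.of_forall fun n => hu n)
  exact h.completeSpace_coe

instance completeSpace_Y [CompleteSpace X] : CompleteSpace (Y X) :=
  inferInstanceAs (CompleteSpace (BUC X ⧸ C0 X))

instance completeSpace_orbitSpan [CompleteSpace X] (f : BUC X) : CompleteSpace (orbitSpan f) :=
  (Submodule.isClosed_topologicalClosure _).completeSpace_coe

theorem norm_cls_le (f : BUC X) : ‖cls f‖ ≤ ‖f‖ := Submodule.Quotient.norm_mk_le (C0 X) f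

theorem BUC.norm_le {f : BUC X} {C : ℝ} (hC : 0 ≤ C) : ‖f‖ ≤ C ↔ ∀ s, ‖f.1 s‖ ≤ C :=
  BoundedContinuousFunction.norm_le hC

theorem norm_shift_le (t : ℝ) (f : BUC X) : ‖shift t f‖ ≤ ‖f‖ :=
  (BUC.norm_le (norm_nonneg _)).2 fun _ => BoundedContinuousFunction.norm_coe_le_norm f.1 _

theorem norm_shiftQ_le (t : ℝ) (y : Y X) : ‖shiftQ t y‖ ≤ ‖y‖ := by
  refine le_of_forall_pos_le_add fun ε hε => ?_
  obtain ⟨f, hf, hlt⟩ := Submodule.Quotient.norm_mk_lt (S := C0 X) y hε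
  have hf' : cls f = y := hf
  rw [← hf', shiftQ_cls]
  refine (norm_cls_le _).trans ((norm_shift_le t f).trans ?_)
  rw [hf']
  exact hlt.le

/-- The quotient norm only sees the behaviour at infinity. -/
theorem norm_cls_le_of_forall_ge {f : BUC X} {C : ℝ} (hC : 0 ≤ C) (T : ℝ≥0)
    (h : ∀ s, T ≤ s → ‖f.1 s‖ ≤ C) : ‖cls f‖ ≤ C := by
  -- Shifting left by `T` discards the values before `T`; shifting back restores the class and is a
  -- contraction.
  have e : cls f = shiftQ (-(T : ℝ)) (cls (shift T f)) := by
    rw [← shiftQ_cls, ← shiftQ_add, neg_add_cancel, shiftQ_zero]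
  rw [e]
  refine (norm_shiftQ_le _ _).trans ((norm_cls_le _).trans ((BUC.norm_le hC).2 fun s => ?_))
  rw [shift_apply_of_nonneg]
  exact h _ le_add_self

theorem tendsto_shift_zero (f : BUC X) : Tendsto (fun t => shift t f) (𝓝 0) (𝓝 f) := by
  rw [Metric.tendsto_nhds]
  intro ε hε
  have hf : UniformContinuous f.1 := f.2
  obtain ⟨δ, hδ, h⟩ := Metric.uniformContinuous_iff.1 hf (ε / 2) (half_pos hε)
  filter_upwards [Metric.ball_mem_nhds 0 hδ] with t ht
  rw [dist_eq_norm]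
  refine ((BUC.norm_le (half_pos hε).le).2 fun s => ?_).trans_lt (half_lt_self hε)
  change ‖f.1 ((s : ℝ) + t).toNNReal - f.1 s‖ ≤ _
  rw [← dist_eq_norm]
  refine (h ?_).le
  calc dist ((s : ℝ) + t).toNNReal s
      = dist ((s : ℝ) + t).toNNReal (s : ℝ).toNNReal := by rw [Real.toNNReal_coe]
    _ ≤ dist ((s : ℝ) + t) s := by
      simpa using Real.lipschitzWith_toNNReal.dist_le_mul ((s : ℝ) + t) s
    _ < δ := by simpa [Real.dist_eq] using ht

theorem isContractionGroup_shiftQ : IsContractionGroup (shiftQ : ℝ → Y X →L[ℂ] Y X) where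
  map_zero := shiftQ_zero
  map_add := shiftQ_add
  norm_le := norm_shiftQ_le
  tendsto_zero y := by
    obtain ⟨f, rfl⟩ := cls_surjective y
    exact (cls.continuous.tendsto f).comp (tendsto_shift_zero f)

theorem isContractionGroup_shiftOn (f : BUC X) : IsContractionGroup (shiftOn f) where
  map_zero _ := Subtype.ext (shiftQ_zero _)
  map_add s t _ := Subtype.ext (shiftQ_add s t _)
  norm_le t _ := norm_shiftQ_le t _
  tendsto_zero _ := tendsto_subtype_rng.2 (isContractionGroup_shiftQ.tendsto_zero _)

/-! ### Identification of `opDQ` with the generator -/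

/-- Uniform continuity of `u'` and the mean value inequality make the difference quotients converge
uniformly in the base point. -/
theorem quotDerivGraph_le : quotDerivGraph X ≤ (generator (shiftQ (X := X))).graph := by
  rintro _ ⟨⟨u, g⟩, hug, rfl⟩
  have hug' : (u, g) ∈ derivGraph X := by rw [← opD_graph]; exact hug
  change (cls u, cls g) ∈ (generator (shiftQ (X := X))).graph
  rw [mem_generator_graph_iff shiftQ_zero, hasDerivAt_iff_isLittleO, Asymptotics.isLittleO_iff]
  intro ε hε
  have hg : UniformContinuous g.1 := g.2
  obtain ⟨δ, hδ, hgδ⟩ := Metric.uniformContinuous_iff.1 hg ε hε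
  filter_upwards [Metric.ball_mem_nhds 0 hδ] with t ht
  rw [mem_ball_zero_iff, Real.norm_eq_abs] at ht
  rw [sub_zero, shiftQ_zero, shiftQ_cls, ← Complex.coe_smul, ← map_smul, ← map_sub, ← map_sub]
  -- Only `s ≥ δ` is tested, so that `s + t` stays in the half line when `t < 0`.
  refine norm_cls_le_of_forall_ge (by positivity) δ.toNNReal fun s hs => ?_
  have hs' : δ ≤ s := Real.toNNReal_le_iff_le_coe.1 hs
  have hpos : ∀ r ∈ uIcc (s : ℝ) (s + t), 0 ≤ r ∧ |r - s| < δ := by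
    intro r hr
    have h1 : |r - s| ≤ |(s + t) - s| := abs_sub_left_of_mem_uIcc hr
    rw [add_sub_cancel_left] at h1
    have h2 := h1.trans_lt ht
    exact ⟨by linarith [(abs_lt.1 h2).1], h2⟩
  have hder : ∀ r ∈ uIcc (s : ℝ) (s + t), HasDerivWithinAt
      (fun r : ℝ => u.1 r.toNNReal - r • g.1 s) (g.1 r.toNNReal - (1 : ℝ) • g.1 s)
      (uIcc (s : ℝ) (s + t)) r := by
    intro r hr
    have h1 := hug' r.toNNReal
    rw [Real.coe_toNNReal r (hpos r hr).1] at h1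
    exact (h1.mono fun q hq => (hpos q hq).1).sub ((hasDerivWithinAt_id _ _).smul_const _)
  have hbd : ∀ r ∈ uIcc (s : ℝ) (s + t), ‖g.1 r.toNNReal - (1 : ℝ) • g.1 s‖ ≤ ε := by
    intro r hr
    rw [one_smul, ← dist_eq_norm]
    refine (hgδ ?_).le
    rw [NNReal.dist_eq, Real.coe_toNNReal r (hpos r hr).1]
    exact (hpos r hr).2
  have key := (convex_uIcc (s : ℝ) (s + t)).norm_image_sub_le_of_norm_hasDerivWithin_le hder hbd
    left_mem_uIcc right_mem_uIcc
  rw [Real.toNNReal_coe, add_sub_cancel_left] at key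
  refine le_of_eq_of_le ?_ key
  change ‖u.1 ((s : ℝ) + t).toNNReal - u.1 s - (t : ℂ) • g.1 s‖ = _
  rw [Complex.coe_smul]
  congr 1
  module

/-- Solvability of `u - u' = g` in `BUC(ℝ⁺, X)`. -/
theorem exists_sub_mem_derivGraph [CompleteSpace X] (g : BUC X) :
    ∃ u : BUC X, (u, u - g) ∈ derivGraph X := by
  -- The bounded solution is `v s = e^s ∫_s^∞ e^{-r} g(r) dr`. Clamping by `toNNReal` extends `g` by
  -- `g 0` to negative times, so the calculus takes place on all of `ℝ`.
  set k : ℝ → X := fun r => Real.exp (-r) • g.1 r.toNNReal with hk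
  have hkc : Continuous k := by
    have := g.1.continuous
    fun_prop
  have hkb : ∀ r, ‖k r‖ ≤ ‖g‖ * Real.exp (-r) := by
    intro r
    rw [hk, norm_smul, Real.norm_of_nonneg (Real.exp_pos _).le, mul_comm]
    gcongr
    exact BoundedContinuousFunction.norm_coe_le_norm g.1 _
  have hbi : ∀ s, IntegrableOn (fun r : ℝ => ‖g‖ * Real.exp (-r)) (Ioi s) := fun s =>
    (integrableOn_exp_neg_Ioi s).const_mul _
  have hki : ∀ s, IntegrableOn k (Ioi s) := fun s =>
    Integrable.mono' (hbi s) hkc.aestronglyMeasurable (Eventually.of_forall hkb)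
  set v : ℝ → X := fun s => Real.exp s • ∫ r in Ioi s, k r with hv
  have hvb : ∀ s, ‖v s‖ ≤ ‖g‖ := by
    intro s
    rw [hv, norm_smul, Real.norm_of_nonneg (Real.exp_pos _).le]
    have h1 : ‖∫ r in Ioi s, k r‖ ≤ ‖g‖ * Real.exp (-s) := by
      refine (norm_integral_le_of_norm_le (hbi s) (Eventually.of_forall hkb)).trans_eq ?_
      rw [integral_const_mul, integral_exp_neg_Ioi]
    calc Real.exp s * ‖∫ r in Ioi s, k r‖ ≤ Real.exp s * (‖g‖ * Real.exp (-s)) := by gcongr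
      _ = ‖g‖ * (Real.exp s * Real.exp (-s)) := by ring
      _ = ‖g‖ := by rw [← Real.exp_add, add_neg_cancel, Real.exp_zero, mul_one]
  have hvd : ∀ s, HasDerivAt v (v s - g.1 s.toNNReal) s := by
    intro s
    have h1 : (fun s => ∫ r in Ioi s, k r) =
        fun s => (∫ r in Ioi (0 : ℝ), k r) - ∫ r in (0 : ℝ)..s, k r := by
      ext s
      rw [eq_sub_iff_add_eq, add_comm]
      exact intervalIntegral.integral_interval_add_Ioi (hki 0) (hki s)
    have h2 : HasDerivAt (fun s => ∫ r in Ioi s, k r) (-k s) s := by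
      rw [h1]
      exact (hkc.integral_hasStrictDerivAt 0 s).hasDerivAt.const_sub _
    refine ((Real.hasDerivAt_exp s).smul h2).congr_deriv ?_
    rw [hk, smul_neg, smul_smul, ← Real.exp_add, add_neg_cancel, Real.exp_zero, one_smul, hv]
    abel
  -- Uniform continuity of `v` follows from `v' = v - g`, where both terms are bounded by `‖g‖`.
  have hlip : LipschitzWith (2 * ‖g‖₊) v := by
    refine lipschitzWith_of_nnnorm_deriv_le (fun s => (hvd s).differentiableAt) fun s => ?_
    rw [(hvd s).deriv, ← NNReal.coe_le_coe]
    have h1 : ‖g.1 s.toNNReal‖ ≤ ‖g‖ := BoundedContinuousFunction.norm_coe_le_norm g.1 _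
    calc ‖v s - g.1 s.toNNReal‖ ≤ ‖v s‖ + ‖g.1 s.toNNReal‖ := norm_sub_le _ _
      _ ≤ ‖g‖ + ‖g‖ := add_le_add (hvb s) h1
      _ = _ := by push_cast; ring
  have huc : UniformContinuous fun s : ℝ≥0 => v s :=
    hlip.uniformContinuous.comp uniformContinuous_subtype_val
  refine ⟨⟨BoundedContinuousFunction.ofNormedAddCommGroup (fun s : ℝ≥0 => v s) huc.continuous ‖g‖
    fun s => hvb s, huc⟩, fun t => ?_⟩
  have h1 : HasDerivWithinAt v (v t - g.1 t) (Ici 0) t := by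
    have h := (hvd t).hasDerivWithinAt (s := Ici 0)
    rwa [Real.toNNReal_coe] at h
  refine h1.congr_of_mem (fun s hs => ?_) t.2
  change v (s.toNNReal : ℝ) = v s
  rw [Real.coe_toNNReal s hs]

/-- The generator extends `opDQ`; as `1 - opDQ` is already onto and `1 - generator` is injective,
the extension is not proper. -/
theorem opDQ_eq_generator [CompleteSpace X] : opDQ X = generator shiftQ := by
  refine LinearPMap.eq_of_eq_graph ?_
  rw [opDQ_graph]
  refine le_antisymm quotDerivGraph_le ?_
  rintro ⟨x, y⟩ hxy
  obtain ⟨g, hg⟩ := cls_surjective (x - y)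
  obtain ⟨u, hu⟩ := exists_sub_mem_derivGraph g
  have hmem : (cls u, cls (u - g)) ∈ quotDerivGraph X :=
    ⟨(u, u - g), by rw [opD_graph]; exact hu, rfl⟩
  obtain ⟨R, hR, -⟩ := isContractionGroup_shiftQ (X := X).exists_isResolvent (z := 1) (by simp)
  have hR' := (isResolvent_iff_graph.1 hR).2
  have h1 := hR' _ _ hxy
  have h2 := hR' _ _ (quotDerivGraph_le hmem)
  rw [one_smul, ← hg] at h1
  rw [one_smul, ← map_sub, sub_sub_cancel, h1] at h2
  rw [map_sub, hg, ← h2, sub_sub_cancel] at hmem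
  exact hmem

/-! ### Resolvents on the orbit span -/

theorem coe_mem_opDQ_graph [CompleteSpace X] {f : BUC X} {x y : orbitSpan f}
    (h : (x, y) ∈ (genOn f).graph) : ((x : Y X), (y : Y X)) ∈ (opDQ X).graph := by
  rw [opDQ_eq_generator, generator_graph]
  rw [genOn, generator_graph] at h
  exact (continuous_subtype_val.tendsto y).comp h

/-- The graph of `genOn f` lies in that of `opDQ`, so a solution of the resolvent equation in the
subspace is the solution in the whole quotient. -/
theorem coe_resolvent_genOn [CompleteSpace X] {f : BUC X} {z : ℂ}
    (hz : z ∈ resolventSet (genOn f)) (hz' : z ∈ resolventSet (opDQ X)) (g : orbitSpan f) :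
    (resolvent (genOn f) z g : Y X) = resolvent (opDQ X) z g := by
  have h := coe_mem_opDQ_graph ((isResolvent_iff_graph.1 (isResolvent_resolvent hz)).1 g)
  have h2 := (isResolvent_iff_graph.1 (isResolvent_resolvent hz')).2 _ _ h
  rw [← h2]
  congr 1
  simp

/-- Translations map the graph of the generator into itself. -/
theorem resolvent_shiftQ [CompleteSpace X] {z : ℂ} (hz : z ∈ resolventSet (opDQ X)) (t : ℝ)
    (y : Y X) : resolvent (opDQ X) z (shiftQ t y) = shiftQ t (resolvent (opDQ X) z y) := by
  have hR := isResolvent_iff_graph.1 (isResolvent_resolvent hz)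
  have h := hR.1 y
  rw [opDQ_eq_generator] at h
  have h1 := isContractionGroup_shiftQ.map_mem_graph t h
  rw [← opDQ_eq_generator] at h1
  rw [← hR.2 _ _ h1]
  congr 1
  simp

theorem cls_mem_orbitSpan (f : BUC X) : cls f ∈ orbitSpan f :=
  Submodule.le_topologicalClosure _ (Submodule.subset_span ⟨0, shiftQ_zero _⟩)

/-- Off the imaginary axis, a bound `C / |Re w|` for an analytic function extends across the
centre of a disc. -/
theorem norm_le_of_norm_le_div_abs_re {F : Type*} [NormedAddCommGroup F] [NormedSpace ℂ F]
    {H : ℂ → F} {z : ℂ} {r C : ℝ} (hz : z.re = 0) (hr : 0 < r) (hC : 0 ≤ C)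
    (hH : AnalyticOnNhd ℂ H (Metric.closedBall z r))
    (hb : ∀ w ∈ Metric.closedBall z r, w.re ≠ 0 → ‖H w‖ ≤ C / |w.re|) {ε : ℝ} (hε : |ε| ≤ r) :
    ‖H (z + ε)‖ ≤ 2 * C / r := by
  -- On the circle `|w - z| = r` this factor has modulus `2 |Re w| / r`, cancelling the singularity
  -- of the bound on `H`; on the real diameter it is at least `1`.
  set Φ : ℂ → F := fun w => (1 + (w - z) ^ 2 / (r : ℂ) ^ 2) • H w with hΦ
  have hr' : (r : ℂ) ≠ 0 := by exact_mod_cast hr.ne'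
  have hd : DifferentiableOn ℂ Φ (Metric.closedBall z r) := by
    have := hH.differentiableOn
    fun_prop
  have hfr : ∀ w ∈ frontier (Metric.ball z r), ‖Φ w‖ ≤ 2 * C / r := by
    intro w hw
    rw [frontier_ball z hr.ne', mem_sphere_iff_norm] at hw
    have hre : (w - z).re = w.re := by rw [Complex.sub_re, hz, sub_zero]
    have e : 1 + (w - z) ^ 2 / (r : ℂ) ^ 2 = (w - z) * (2 * w.re : ℝ) / (r : ℂ) ^ 2 := by
      have h1 : (r : ℂ) ^ 2 = (w - z) * (starRingEnd ℂ) (w - z) := by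
        rw [Complex.mul_conj, Complex.normSq_eq_norm_sq, hw]
        push_cast
        ring
      rw [eq_div_iff (pow_ne_zero 2 hr'), add_mul, one_mul, div_mul_cancel₀ _ (pow_ne_zero 2 hr'),
        ← hre, ← Complex.add_conj]
      nth_rw 1 [h1]
      ring
    have hn : ‖1 + (w - z) ^ 2 / (r : ℂ) ^ 2‖ = 2 * |w.re| / r := by
      rw [e, norm_div, norm_mul, hw, Complex.norm_real, norm_pow, Complex.norm_real,
        Real.norm_of_nonneg hr.le, norm_mul, Real.norm_eq_abs, Real.norm_eq_abs, abs_two]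
      field_simp
    rw [hΦ, norm_smul, hn]
    -- At the two points of the circle on the axis no bound on `H` is given, but the factor vanishes
    -- there.
    by_cases h0 : w.re = 0
    · rw [h0]
      simp only [abs_zero, mul_zero, zero_div, zero_mul]
      positivity
    · have hb' := hb w (by rw [mem_closedBall_iff_norm, hw]) h0
      have hp : 0 < |w.re| := abs_pos.2 h0
      calc 2 * |w.re| / r * ‖H w‖ ≤ 2 * |w.re| / r * (C / |w.re|) := by gcongr
        _ = 2 * C / r := by field_simp
  have hmem : z + ε ∈ Metric.closedBall z r := by
    rw [mem_closedBall_iff_norm, add_sub_cancel_left, Complex.norm_real]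
    exact hε
  have hdc : DiffContOnCl ℂ Φ (Metric.ball z r) := by
    refine DifferentiableOn.diffContOnCl ?_
    rwa [closure_ball z hr.ne']
  have key := Complex.norm_le_of_forall_mem_frontier_norm_le Metric.isBounded_ball hdc hfr
    (z := z + ε) (by rwa [closure_ball z hr.ne'])
  refine le_trans ?_ key
  rw [hΦ, norm_smul]
  refine le_mul_of_one_le_left (norm_nonneg _) ?_
  have e : 1 + (z + ε - z) ^ 2 / (r : ℂ) ^ 2 = ((1 + ε ^ 2 / r ^ 2 : ℝ) : ℂ) := by
    push_cast
    rw [add_sub_cancel_left]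
  rw [e, Complex.norm_real, Real.norm_of_nonneg (by positivity)]
  have : 0 ≤ ε ^ 2 / r ^ 2 := by positivity
  linarith

/-- An analytic extension of the transform of `f` yields one of the local resolvents of all
elements of the span of the orbit of `f`. -/
theorem exists_extension_of_mem_span [CompleteSpace X] {f : BUC X} {U : Set ℂ} {G : ℂ → Y X}
    (hG : AnalyticOnNhd ℂ G U) (hGf : ∀ z ∈ U ∩ resolventSet (opDQ X), G z = transform f z)
    {g : Y X} (hg : g ∈ Submodule.span ℂ (range fun t : ℝ => shiftQ t (cls f))) :
    ∃ H : ℂ → Y X, AnalyticOnNhd ℂ H U ∧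
      ∀ z ∈ U ∩ resolventSet (opDQ X), H z = resolvent (opDQ X) z g := by
  induction hg using Submodule.span_induction with
  | mem x hx =>
    obtain ⟨t, rfl⟩ := hx
    refine ⟨fun z => shiftQ t (G z), (shiftQ t).comp_analyticOnNhd hG, fun z hz => ?_⟩
    dsimp only
    rw [hGf z hz, transform, resolvent_shiftQ hz.2]
  | zero => exact ⟨fun _ => 0, analyticOnNhd_const, fun z _ => (map_zero _).symm⟩
  | add x y _ _ h1 h2 =>
    obtain ⟨H1, ha1, hb1⟩ := h1
    obtain ⟨H2, ha2, hb2⟩ := h2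
    refine ⟨fun z => H1 z + H2 z, ha1.add ha2, fun z hz => ?_⟩
    dsimp only
    rw [map_add, hb1 z hz, hb2 z hz]
  | smul c x _ h1 =>
    obtain ⟨H1, ha1, hb1⟩ := h1
    refine ⟨fun z => c • H1 z, analyticOnNhd_const.smul ha1, fun z hz => ?_⟩
    dsimp only
    rw [map_smul, hb1 z hz]

theorem mem_resolventSet_opDQ [CompleteSpace X] {z : ℂ} (hz : z.re ≠ 0) :
    z ∈ resolventSet (opDQ X) := by
  rw [opDQ_eq_generator]
  exact isContractionGroup_shiftQ.mem_resolventSet hz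

theorem norm_resolvent_opDQ_le [CompleteSpace X] {z : ℂ} (hz : z.re ≠ 0) :
    ‖resolvent (opDQ X) z‖ ≤ 1 / |z.re| := by
  rw [opDQ_eq_generator]
  exact isContractionGroup_shiftQ.norm_resolvent_le hz

/-! ### The two inclusions -/

theorem mem_resolventSet_genOn_of_notMem_sp [CompleteSpace X] {f : BUC X} {ξ : ℝ}
    (hξ : ξ ∉ sp f) : Complex.I * ξ ∈ resolventSet (genOn f) := by
  rw [sp, mem_ofPred_eq, not_not] at hξ
  obtain ⟨U, hU, hξU, G, hG, hGf⟩ := hξ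
  set z : ℂ := Complex.I * ξ with hz
  have hzre : z.re = 0 := by simp [hz]
  obtain ⟨r, hr, hrU⟩ := Metric.nhds_basis_closedBall.mem_iff.1 (hU.mem_nhds hξU)
  -- The bound `2 / r` on the resolvent at `w` gives a Neumann disc of radius `r / 2`, which
  -- contains `z` at distance `r / 4`.
  set w : ℂ := z + (r / 4 : ℝ) with hw
  have hwre : w.re = r / 4 := by rw [hw, Complex.add_re, hzre, Complex.ofReal_re, zero_add]
  have hw0 : w.re ≠ 0 := by rw [hwre]; positivity
  have hwU : w ∈ U := hrU <| by
    rw [mem_closedBall_iff_norm, hw, add_sub_cancel_left, Complex.norm_real,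
      Real.norm_of_nonneg (by positivity)]
    linarith
  -- The extension `H` depends on `g` with no control, but the bound involves only `‖g‖`, so it
  -- survives passing to the closure.
  have hspan : ∀ g ∈ Submodule.span ℂ (range fun t : ℝ => shiftQ t (cls f)),
      ‖resolvent (opDQ X) w g‖ ≤ 2 * ‖g‖ / r := by
    intro g hg
    obtain ⟨H, hH, hHg⟩ := exists_extension_of_mem_span hG hGf hg
    rw [← hHg w ⟨hwU, mem_resolventSet_opDQ hw0⟩]
    refine norm_le_of_norm_le_div_abs_re hzre hr (norm_nonneg g) (hH.mono hrU) ?_ ?_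
    · intro v hv hv0
      rw [hHg v ⟨hrU hv, mem_resolventSet_opDQ hv0⟩]
      refine ((resolvent (opDQ X) v).le_of_opNorm_le (norm_resolvent_opDQ_le hv0) g).trans_eq ?_
      ring
    · rw [abs_of_pos (by positivity)]
      linarith
  have hclos : ∀ g ∈ orbitSpan f, ‖resolvent (opDQ X) w g‖ ≤ 2 * ‖g‖ / r := by
    have hcl : IsClosed {g : Y X | ‖resolvent (opDQ X) w g‖ ≤ 2 * ‖g‖ / r} :=
      isClosed_le (by fun_prop) (by fun_prop)
    exact fun g hg => closure_minimal hspan hcl hg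
  have hwres : w ∈ resolventSet (genOn f) := (isContractionGroup_shiftOn f).mem_resolventSet hw0
  have hnorm : ‖resolvent (genOn f) w‖ ≤ 2 / r := by
    refine ContinuousLinearMap.opNorm_le_bound _ (by positivity) fun g => ?_
    rw [Submodule.coe_norm, coe_resolvent_genOn hwres (mem_resolventSet_opDQ hw0)]
    refine (hclos _ g.2).trans_eq ?_
    rw [Submodule.coe_norm]
    ring
  refine ⟨_, isResolvent_of_norm_lt (isResolvent_resolvent hwres) ?_⟩
  rw [norm_smul, hw, add_sub_cancel_left, Complex.norm_real, Real.norm_of_nonneg (by positivity)]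
  calc r / 4 * ‖resolvent (genOn f) (z + (r / 4 : ℝ))‖ ≤ r / 4 * (2 / r) := by gcongr
    _ = 1 / 2 := by field_simp; norm_num
    _ < 1 := by norm_num

theorem notMem_sp_of_mem_resolventSet_genOn [CompleteSpace X] {f : BUC X} {ξ : ℝ}
    (hξ : Complex.I * ξ ∈ resolventSet (genOn f)) : ξ ∉ sp f := by
  rw [sp, mem_ofPred_eq, not_not]
  refine ⟨_, isOpen_resolventSet (genOn f), hξ,
    fun z => (resolvent (genOn f) z ⟨cls f, cls_mem_orbitSpan f⟩ : Y X), ?_, ?_⟩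
  · intro z hz
    have h1 := analyticOnNhd_resolvent (genOn f) z hz
    exact (((orbitSpan f).subtypeL.comp (ContinuousLinearMap.apply ℂ (orbitSpan f)
      ⟨cls f, cls_mem_orbitSpan f⟩)).analyticAt _).comp h1
  · rintro z ⟨hz, hz'⟩
    exact coe_resolvent_genOn hz hz' _

end HalfLine

end

theorem mainTheorem6 {X : Type*} [NormedAddCommGroup X] [NormedSpace ℂ X] [CompleteSpace X]
    (f : HalfLine.BUC X) :
    (fun ξ : ℝ => Complex.I * (ξ : ℂ)) '' HalfLine.sp f =
      UnboundedOp.spectrum (HalfLine.genOn f) := by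
  ext z
  constructor
  · rintro ⟨ξ, hξ, rfl⟩ h
    exact HalfLine.notMem_sp_of_mem_resolventSet_genOn h hξ
  · intro h
    -- The spectrum of an isometry group's generator lies on the imaginary axis, so `z` has the form
    -- `iξ`.
    have hz : z.re = 0 := by
      by_contra hz
      exact h ((HalfLine.isContractionGroup_shiftOn f).mem_resolventSet hz)
    have e : Complex.I * (z.im : ℂ) = z := by
      apply Complex.ext <;> simp [hz]
    refine ⟨z.im, ?_, e⟩
    by_contra hsp
    exact h (e ▸ HalfLine.mem_resolventSet_genOn_of_notMem_sp hsp)
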